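/- **Definitions.** Fix $\Delta\ge 3$. A *node-edge-checkable problem* $\Pi=(\Sigma_\Pi,\mathcal N_\Pi,\mathcal E_\Pi)$ consists of a finite label set $\Sigma_\Pi$, a set $\mathcal N_\Pi$ of cardinality-$\Delta$ multisets of labels (node configurations) and a set $\mathcal E_\Pi$ of cardinality-$2$ multisets of labels (edge configurations). A correct solution on a $\Delta$-regular tree (a finite tree in which all nodes that are not leaves have degree $\Delta$) labels the half-edges so that the labels at each node of degree $\Delta$ form an element of $\mathcal N_\Pi$ and the labels on each edge form an element of $\mathcal E_\Pi$. Write the node configurations of $\Pi$ as $L_{i1}\,\dots\,L_{i\Delta}$, $1\le i\le z$. A problem $\hat\Pi$ is a *relaxation* of $\Pi$, written $\Pi\xrightarrow{0}\hat\Pi$, if one can map every occurrence $L_{ij}$ to a label $f(L_{ij})\in\Sigma_{\hat\Pi}$ (depending on $i$ and $j$, not only on the label) such that $f(L_{i1})\,\dots\,f(L_{i\Delta})\in\mathcal N_{\hat\Pi}$ for all $i$, and $f(L_{ij})\,f(L_{i'j'})\in\mathcal E_{\hat\Pi}$ whenever $L_{ij}\,L_{i'j'}\in\mathcal E_\Pi$.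 The problem $\mathcal R(\Pi)$ is defined as follows. Its edge configurations are the maximal ones among the configurations $S_1\,S_2$ of nonempty subsets of $\Sigma_\Pi$ such that $L_1\,L_2\in\mathcal E_\Pi$ for all $L_1\in S_1$, $L_2\in S_2$; here a configuration is maximal if it is not possible, in a suitable order, to replace its sets by supersets, at least one of them strictly larger, and obtain another configuration of the collection. Its labels are the sets occurring in these edge configurations. Its node configurations are all $S_1\,\dots\,S_\Delta$ of such labels for which there are $L_i\in S_i$ with $L_1\,\dots\,L_\Delta\in\mathcal N_\Pi$. The problem $\overline{\mathcal R}(\Pi)$ is defined dually, with the roles of nodes and edges exchanged. Let $\mathcal Q(\Pi)=\overline{\mathcal R}(\mathcal R(\Pi))$. A problem $\mathcal F$ is a *fixed point* if $\mathcal Q(\mathcal F)\xrightarrow{0}\mathcal F$. It is *nontrivial* if it cannot be solved in $0$ rounds, i.e. if no deterministic $0$-round algorithm in the port numbering model (without inputs) produces a correct solution on every $\Delta$-regular tree, whatever its port numbering and edge orientation; in $0$ rounds a node knows the number of nodes, its degree, its ports and the orientation of the edge at each of its ports. A *nontrivial fixed point relaxation* of $\Pi$ is a nontrivial fixed point $\mathcal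 F$ with $\Pi\xrightarrow{0}\mathcal F$. For a finite simple graph $H$, the *homomorphism problem* of $H$ has label set $V(H)$, node configurations $v\,\dots\,v$ for $v\in V(H)$, and edge configurations $u\,v$ for all adjacent $u,v$. Let $H_\Delta$ be the graph with vertex set $\{1,\dots,\Delta\}^2$ in which $(y,z)$ and $(y',z')$ are adjacent iff 1. $y\ne y'$, $z\ne z'$, and ($y\neq 1\neq z$ or $y'\ne 1\ne z'$), or 2. $y=y'=1$, $z\ne1\ne z'$ and $z\neq z'$, or 3. $z=z'=1$, $y\ne1\ne y'$ and $y\ne y'$, and let $\Pi^\Delta$ be the homomorphism problem of $H_\Delta$. A finite graph $H$ has property $\Delta$-(\*) if there are $S_0,S_1\subseteq V(H)$ such that the induced subgraphs $H[S_0]$ and $H[S_1]$ have chromatic number at most $\Delta-1$ and no edge of $H$ joins a vertex of $V(H)\setminus S_0$ to a vertex of $V(H)\setminus S_1$. **Theorem.** For every $\Delta\ge3$: (a) there exists a nontrivial fixed point relaxation of $\Pi^\Delta$; (b) for every finite graph $H$ with property $\Delta$-(\*), there exists a nontrivial fixed point relaxation of the homomorphism problem of $H$. -/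

import Mathlib

namespace RoundElim

/-- The configuration `L 0 … L (k-1)`: the cardinality-`k` multiset listed by the tuple `L`. -/
def conf {α : Type*} {k : ℕ} (L : Fin k → α) : Sym α k :=
  ⟨Finset.univ.val.map L, by simp⟩

/-- A node-edge-checkable problem (on `Δ`-regular graphs and trees): a finite label set, a set of
cardinality-`Δ` multisets of labels (node constraint) and a set of cardinality-`2` multisets of
labels (edge constraint). -/
structure Problem (Δ : ℕ) where
  Label : Type
  finite_label : Finite Label
  node : Set (Sym Label Δ)
  edge : Set (Sym Label 2)

attribute [instance] Problem.finite_label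

variable {Δ : ℕ}

/-- `P'` is a relaxation of `P`. Here `L c 0, …, L c (Δ-1)` lists the occurrences of labels in the
node configuration `c` of `P`, and `f c j` is the label to which the `j`-th occurrence is mapped;
so `f` may map the same label differently in different configurations, and even at different
occurrences in the same configuration. -/
def Relaxes (P P' : Problem Δ) : Prop :=
  ∃ L : P.node → Fin Δ → P.Label, (∀ c, conf (L c) = c.1) ∧
    ∃ f : P.node → Fin Δ → P'.Label,
      (∀ c, conf (f c) ∈ P'.node) ∧
      ∀ c c' j j', conf ![L c j, L c' j'] ∈ P.edge → conf ![f c j, f c' j'] ∈ P'.edge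

section Operators

variable {α : Type*} {k : ℕ}

/-- Configurations of nonempty sets, every choice from which lies in `C`. -/
def forallConf (C : Set (Sym α k)) : Set (Sym (Set α) k) :=
  {c | ∃ S : Fin k → Set α, conf S = c ∧ (∀ i, (S i).Nonempty) ∧
    ∀ L : Fin k → α, (∀ i, L i ∈ S i) → conf L ∈ C}

/-- Configurations of sets, some choice from which lies in `C`. -/
def existsConf (C : Set (Sym α k)) : Set (Sym (Set α) k) :=
  {c | ∃ S : Fin k → Set α, conf S = c ∧
    ∃ L : Fin k → α, (∀ i, L i ∈ S i) ∧ conf L ∈ C}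

/-- `c` is dominated by `c'`: with suitable orderings of the two configurations each set of `c` is
contained in the corresponding set of `c'`, at least once strictly. -/
def DominatedBy (c c' : Sym (Set α) k) : Prop :=
  ∃ S S' : Fin k → Set α, conf S = c ∧ conf S' = c' ∧ (∀ i, S i ⊆ S' i) ∧ ∃ i, S i ⊂ S' i

/-- The maximal configurations of a collection of configurations of sets. -/
def maximalConf (C : Set (Sym (Set α) k)) : Set (Sym (Set α) k) :=
  {c | c ∈ C ∧ ¬ ∃ c' ∈ C, DominatedBy c c'}

/-- The sets that occur in some configuration of `C`. -/
abbrev Occurring (C : Set (Sym (Set α) k)) : Type _ :=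
  {S : Set α // ∃ c ∈ C, S ∈ c}

end Operators

/-- The operator `R`: universal quantifier (and maximality) on the edges, existential quantifier
on the nodes. -/
def re (P : Problem Δ) : Problem Δ where
  Label := Occurring (maximalConf (forallConf P.edge))
  finite_label := Subtype.finite
  edge := {c | c.map Subtype.val ∈ maximalConf (forallConf P.edge)}
  node := {c | c.map Subtype.val ∈ existsConf P.node}

/-- The dual operator: universal quantifier (and maximality) on the nodes, existential quantifier
on the edges. -/
def rere (P : Problem Δ) : Problem Δ where
  Label := Occurring (maximalConf (forallConf P.node))
  finite_label := Subtype.finite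
  node := {c | c.map Subtype.val ∈ maximalConf (forallConf P.node)}
  edge := {c | c.map Subtype.val ∈ existsConf P.edge}

/-- One step of round elimination. -/
def roundElim (P : Problem Δ) : Problem Δ := rere (re P)

/-- A fixed point: `P` is a relaxation of the problem obtained from it by one round elimination
step. -/
def IsFixedPoint (P : Problem Δ) : Prop := Relaxes (roundElim P) P

/-- A finite simple graph with a port numbering of the half-edges at each node (`port v i` is the
neighbour of `v` reached through port `i`) and an orientation of the edges (`out v w = true` means
that the edge `vw` is oriented from `v` to `w`). -/
structure Network where
  V : Type
  finite_V : Finite V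
  G : SimpleGraph V
  deg : V → ℕ
  port : ∀ v, Fin (deg v) ≃ G.neighborSet v
  out : V → V → Bool
  out_symm : ∀ u v, G.Adj u v → out u v = !(out v u)

/-- The network is a `Δ`-regular tree: a tree in which every node has degree `Δ` or is a leaf. -/
def Network.IsRegularTree (Δ : ℕ) (N : Network) : Prop :=
  N.G.IsTree ∧ ∀ v, N.deg v = 1 ∨ N.deg v = Δ

/-- `ℓ` (a labelling of the half-edges `(v, vw)`) is a correct solution of `P`: every node of
degree `Δ` satisfies the node constraint and every edge satisfies the edge constraint. The bijection
`e` lists the half-edges at `v`, and exists exactly when `v` has degree `Δ`. -/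
def IsSolution (P : Problem Δ) {V : Type} (G : SimpleGraph V)
    (ℓ : ∀ v, G.neighborSet v → P.Label) : Prop :=
  (∀ v, ∀ e : Fin Δ ≃ G.neighborSet v, conf (fun i => ℓ v (e i)) ∈ P.node) ∧
  ∀ (u v : V) (h : G.Adj u v), conf ![ℓ u ⟨v, h⟩, ℓ v ⟨u, h.symm⟩] ∈ P.edge

/-- A deterministic `0`-round algorithm of the port numbering model: from the number of nodes, its
own degree and the orientations of the edges at its ports, a node computes the output label for
each of its ports. -/
abbrev ZeroRoundAlgorithm (Λ : Type) : Type :=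
  (n d : ℕ) → (Fin d → Bool) → Fin d → Λ

/-- The half-edge labelling computed by a `0`-round algorithm on a network. -/
noncomputable def ZeroRoundAlgorithm.output {Λ : Type} (A : ZeroRoundAlgorithm Λ) (N : Network)
    (v : N.V) (w : N.G.neighborSet v) : Λ :=
  A (Nat.card N.V) (N.deg v) (fun i => N.out v (N.port v i)) ((N.port v).symm w)

/-- `P` can be solved in `0` rounds (deterministic port numbering model, `Δ`-regular trees). -/
def ZeroRoundSolvable (P : Problem Δ) : Prop :=
  ∃ A : ZeroRoundAlgorithm P.Label, ∀ N : Network, N.IsRegularTree Δ →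
    IsSolution P N.G (A.output N)

/-- `F` is a nontrivial fixed point relaxation of `P`. -/
def IsNontrivialFixedPointRelaxation (P F : Problem Δ) : Prop :=
  Relaxes P F ∧ IsFixedPoint F ∧ ¬ ZeroRoundSolvable F

/-- The homomorphism problem with finite target graph `H`: all half-edges at a node get the same
vertex of `H`, and the two half-edges of an edge get adjacent vertices of `H`. -/
def homProblem (Δ : ℕ) {W : Type} [Finite W] (H : SimpleGraph W) : Problem Δ where
  Label := W
  finite_label := inferInstance
  node := {c | ∃ w, c = conf fun _ => w}
  edge := {c | ∃ w w', H.Adj w w' ∧ c = conf ![w, w']}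

/-- The graph `H_Δ` on `{1, …, Δ} × {1, …, Δ}`; the element `i` of `{1, …, Δ}` is represented by
`i - 1` in `Fin Δ`, so that `1` becomes the element with value `0`. -/
def targetGraph (Δ : ℕ) : SimpleGraph (Fin Δ × Fin Δ) where
  Adj p q :=
    ((p.1.val ≠ 0 ∧ p.2.val ≠ 0 ∨ q.1.val ≠ 0 ∧ q.2.val ≠ 0) ∧ p.1 ≠ q.1 ∧ p.2 ≠ q.2) ∨
    (p.1.val = 0 ∧ q.1.val = 0 ∧ p.2.val ≠ 0 ∧ q.2.val ≠ 0 ∧ p.2 ≠ q.2) ∨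
    (p.2.val = 0 ∧ q.2.val = 0 ∧ p.1.val ≠ 0 ∧ q.1.val ≠ 0 ∧ p.1 ≠ q.1)
  symm := ⟨fun p q h => by
    rcases h with ⟨h, h1, h2⟩ | ⟨h1, h2, h3, h4, h5⟩ | ⟨h1, h2, h3, h4, h5⟩
    · exact Or.inl ⟨h.symm, h1.symm, h2.symm⟩
    · exact Or.inr (Or.inl ⟨h2, h1, h4, h3, h5.symm⟩)
    · exact Or.inr (Or.inr ⟨h2, h1, h4, h3, h5.symm⟩)⟩
  loopless := ⟨fun p h => by
    rcases h with ⟨_, h1, _⟩ | ⟨_, _, _, _, h5⟩ | ⟨_, _, _, _, h5⟩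
    · exact h1 rfl
    · exact h5 rfl
    · exact h5 rfl⟩

/-- Property `Δ`-(*): there are vertex sets `S₀`, `S₁`, each inducing a subgraph of chromatic number
at most `Δ - 1`, such that no edge joins the complement of `S₀` to the complement of `S₁`. -/
def DeltaStar (Δ : ℕ) {W : Type} (H : SimpleGraph W) : Prop :=
  ∃ S₀ S₁ : Set W, (H.induce S₀).Colorable (Δ - 1) ∧ (H.induce S₁).Colorable (Δ - 1) ∧
    ∀ u ∉ S₀, ∀ v ∉ S₁, ¬ H.Adj u v

end RoundElim

/-! A single problem, `doubleColoring Δ`, serves for both parts. It runs two relaxed `Δ`-colorings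
at once, one per side `b`. An ordinary class conflicts with itself, whereas the two special classes
conflict only with each other. Property `Δ`-(*) provides such a pair of colorings of `H`: color `S₀`
and `S₁` with the ordinary colors and give each complement the special color of its side
(`DeltaStar.relaxes`). The graph `H_Δ` has the property (`deltaStar_targetGraph`).

The fixed point property rests on Hall's theorem: the node constraint of a side says exactly that
its classes cannot be matched to positions where they are missing (`exists_perm_notMem`). A failing
node would give such a matching, and the matching then survives in a choice that has to satisfy the
node constraint.

For nontriviality, double stars show that outputs at any out-port and any in-port must be
compatible. A counting argument over threshold orientations gives, on each side, a class output at
both kinds of ports (`exists_class_out_in`). Such a class has to be special, and the special classes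
of the two sides then conflict. -/

namespace RoundElim

/-! ### Configurations as tuples up to permutation -/

section Configurations

variable {α β : Type*} {k : ℕ}

theorem val_conf (L : Fin k → α) : (conf L).1 = Finset.univ.val.map L := rfl

theorem conf_eq_conf_iff {L L' : Fin k → α} :
    conf L = conf L' ↔ ∃ σ : Equiv.Perm (Fin k), L = L' ∘ σ := by
  classical
  refine ⟨fun h => ?_, ?_⟩
  · have hcard (c : α) : Nonempty ({i // L i = c} ≃ {i // L' i = c}) := by
      have := congrArg (fun s : Sym α k => s.1.count c) h
      simp only [val_conf, Multiset.count_map] at this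
      refine ⟨Fintype.equivOfCardEq ?_⟩
      rw [Fintype.card_subtype, Fintype.card_subtype]
      simpa only [Finset.card_def, Finset.filter_val, eq_comm] using this
    have e (c : α) := (hcard c).some
    exact ⟨Equiv.ofFiberEquiv e, funext fun i => (Equiv.ofFiberEquiv_map e i).symm⟩
  · rintro ⟨σ, rfl⟩
    refine Subtype.ext ?_
    rw [val_conf, val_conf, ← Multiset.map_map, Multiset.map_univ_val_equiv]

theorem conf_comp_perm (L : Fin k → α) (σ : Equiv.Perm (Fin k)) : conf (L ∘ σ) = conf L :=
  conf_eq_conf_iff.2 ⟨σ, rfl⟩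

theorem exists_conf_eq (c : Sym α k) : ∃ L : Fin k → α, conf L = c := by
  obtain ⟨m, rfl⟩ := c
  induction m using Quotient.inductionOn with
  | h l =>
    have h : Finset.univ.val.map l.get = (l : Multiset α) := by
      rw [Fin.univ_val_map, List.ofFn_get]
    exact ⟨l.get, Subtype.ext h⟩

theorem map_conf (g : α → β) (L : Fin k → α) : (conf L).map g = conf (g ∘ L) :=
  Subtype.ext (Multiset.map_map g L Finset.univ.val)

theorem conf_comp_mem_of_map_mem {C : Set (Sym β k)} {g : α → β} {L : Fin k → α}
    (h : (conf L).map g ∈ C) : conf (g ∘ L) ∈ C := by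
  rwa [map_conf] at h

theorem conf_mem_forallConf {C : Set (Sym α k)} {S : Fin k → Set α}
    (h : conf S ∈ forallConf C) (L : Fin k → α) (hL : ∀ i, L i ∈ S i) : conf L ∈ C := by
  obtain ⟨S', hS, -, h⟩ := h
  obtain ⟨σ, rfl⟩ := conf_eq_conf_iff.1 hS
  rw [← conf_comp_perm L σ]
  exact h _ fun i => hL _

theorem exists_conf_mem_of_mem_existsConf {C : Set (Sym α k)} {S : Fin k → Set α}
    (h : conf S ∈ existsConf C) : ∃ L : Fin k → α, (∀ i, L i ∈ S i) ∧ conf L ∈ C := by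
  obtain ⟨S', hS, L, hL, h⟩ := h
  obtain ⟨σ, rfl⟩ := conf_eq_conf_iff.1 hS.symm
  exact ⟨L ∘ σ, fun i => hL _, by rwa [conf_comp_perm]⟩

theorem conf_pair_eq_iff {a b c d : α} :
    conf ![a, b] = conf ![c, d] ↔ a = c ∧ b = d ∨ a = d ∧ b = c := by
  have h : conf ![a, b] = conf ![c, d] ↔ ({a, b} : Multiset α) = {c, d} := Subtype.ext_iff
  rw [h]
  constructor
  · intro h
    rcases Multiset.cons_eq_cons.1 h with ⟨h1, h2⟩ | ⟨-, s, h1, h2⟩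
    · exact Or.inl ⟨h1, Multiset.singleton_inj.1 h2⟩
    · have hs : s = 0 := by
        have := congrArg Multiset.card h1
        simpa using this.symm
      subst hs
      exact Or.inr ⟨(Multiset.singleton_inj.1 h2).symm, Multiset.singleton_inj.1 h1⟩
  · rintro (⟨rfl, rfl⟩ | ⟨rfl, rfl⟩)
    · rfl
    · exact Multiset.pair_comm _ _

end Configurations

/-! ### Consequences of the constraints of one round elimination step -/

variable {Δ : ℕ}

/-- Only the quantifiers of the two operators matter; maximality is discarded here and in the edge
version. -/
theorem choice_mem_node_of_mem_roundElim {P : Problem Δ} (S : Fin Δ → (roundElim P).Label)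
    (hS : conf S ∈ (roundElim P).node) (K : Fin Δ → (re P).Label) (hK : ∀ i, K i ∈ (S i).1) :
    ∃ L : Fin Δ → P.Label, (∀ i, L i ∈ (K i).1) ∧ conf L ∈ P.node := by
  have h1 : conf (fun i => (S i).1) ∈ forallConf (re P).node := conf_comp_mem_of_map_mem hS.1
  have h2 : conf (fun i => (K i).1) ∈ existsConf P.node :=
    conf_comp_mem_of_map_mem (conf_mem_forallConf h1 K hK)
  exact exists_conf_mem_of_mem_existsConf h2

theorem exists_sets_of_mem_roundElim_edge {P : Problem Δ} {S T : (roundElim P).Label}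
    (h : conf ![S, T] ∈ (roundElim P).edge) :
    ∃ K ∈ S.1, ∃ K' ∈ T.1, ∀ a ∈ K.1, ∀ b ∈ K'.1, conf ![a, b] ∈ P.edge := by
  have h1 : conf (Subtype.val ∘ ![S, T]) ∈ existsConf (re P).edge := conf_comp_mem_of_map_mem h
  obtain ⟨L, hL, h2⟩ := exists_conf_mem_of_mem_existsConf h1
  have h3 : conf (fun i => (L i).1) ∈ forallConf P.edge := conf_comp_mem_of_map_mem h2.1
  refine ⟨L 0, hL 0, L 1, hL 1, fun a ha b hb => conf_mem_forallConf h3 _ fun i => ?_⟩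
  fin_cases i
  · exact ha
  · exact hb

/-- To show that `P` is a fixed point, it suffices to send each label of `roundElim P` to one label
of `P`, compatibly with both constraints. -/
theorem isFixedPoint_of_map {P : Problem Δ} (g : (roundElim P).Label → P.Label)
    (hnode : ∀ S, conf S ∈ (roundElim P).node → conf (g ∘ S) ∈ P.node)
    (hedge : ∀ S T, conf ![S, T] ∈ (roundElim P).edge → conf ![g S, g T] ∈ P.edge) :
    IsFixedPoint P := by
  choose L hL using fun c : (roundElim P).node => exists_conf_eq c.1
  refine ⟨L, hL, fun c => g ∘ L c, fun c => hnode _ ?_, fun c c' j j' => hedge _ _⟩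
  rw [hL]
  exact c.2

/-! ### The fixed point -/

/-- The involution that matches the two special classes `(false, 0)` and `(true, 0)` and fixes all
other classes. -/
def partner (x : Bool × Fin Δ) : Bool × Fin Δ :=
  (if x.2.val = 0 then !x.1 else x.1, x.2)

theorem partner_partner (x : Bool × Fin Δ) : partner (partner x) = x := by
  obtain ⟨b, j⟩ := x
  by_cases h : j.val = 0 <;> simp [partner, h]

/-- Two sets of classes may meet on an edge if they contain no two partners. -/
def Compatible (E E' : Set (Bool × Fin Δ)) : Prop :=
  ∀ x ∈ E, partner x ∉ E'

theorem Compatible.symm {E E' : Set (Bool × Fin Δ)} (h : Compatible E E') : Compatible E' E :=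
  fun x hx hx' => h _ hx' (by rwa [partner_partner])

open Classical in
/-- The positions at which the tuple `E` of sets of classes contains all classes `(b, j)` with
`j ∈ C`. -/
noncomputable def positions (E : Fin Δ → Set (Bool × Fin Δ)) (b : Bool) (C : Finset (Fin Δ)) :
    Finset (Fin Δ) :=
  {i | ∀ j ∈ C, (b, j) ∈ E i}

theorem mem_positions {E : Fin Δ → Set (Bool × Fin Δ)} {b : Bool} {C : Finset (Fin Δ)}
    {i : Fin Δ} : i ∈ positions E b C ↔ ∀ j ∈ C, (b, j) ∈ E i := by
  simp [positions]

/-- The node constraint of `doubleColoring`: on each of the two sides, some nonempty set `C` of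
classes is output at `Δ + 1 - |C|` positions. -/
def IsNodeTuple (E : Fin Δ → Set (Bool × Fin Δ)) : Prop :=
  ∀ b, ∃ C : Finset (Fin Δ), C.Nonempty ∧ Δ + 1 ≤ C.card + (positions E b C).card

theorem IsNodeTuple.comp_perm {E : Fin Δ → Set (Bool × Fin Δ)} (h : IsNodeTuple E)
    (σ : Equiv.Perm (Fin Δ)) : IsNodeTuple (E ∘ σ) := by
  intro b
  obtain ⟨C, hC, hcard⟩ := h b
  refine ⟨C, hC, hcard.trans (Nat.add_le_add_left (le_of_eq ?_) _)⟩
  refine Finset.card_bij (fun i _ => σ.symm i) (fun i hi => ?_) (fun i _ j _ h => by simpa using h)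
    fun i hi => ⟨σ i, ?_, by simp⟩
  · simpa [mem_positions] using hi
  · simpa [mem_positions] using hi

/-- The problem whose labels are sets of classes `(b, j)`; it encodes two simultaneous relaxed
`Δ`-colorings, in which the special classes `(false, 0)` and `(true, 0)` only conflict with each
other. -/
def doubleColoring (Δ : ℕ) : Problem Δ where
  Label := Set (Bool × Fin Δ)
  finite_label := inferInstance
  node := {c | ∃ E, conf E = c ∧ IsNodeTuple E}
  edge := {c | ∃ E E', conf ![E, E'] = c ∧ Compatible E E'}

theorem conf_mem_node_iff {E : Fin Δ → Set (Bool × Fin Δ)} :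
    conf E ∈ (doubleColoring Δ).node ↔ IsNodeTuple E := by
  refine ⟨fun ⟨E', h, hE'⟩ => ?_, fun h => ⟨E, rfl, h⟩⟩
  obtain ⟨σ, rfl⟩ := conf_eq_conf_iff.1 h.symm
  exact hE'.comp_perm σ

theorem conf_mem_edge_iff {E E' : Set (Bool × Fin Δ)} :
    conf ![E, E'] ∈ (doubleColoring Δ).edge ↔ Compatible E E' := by
  refine ⟨fun ⟨D, D', h, hD⟩ => ?_, fun h => ⟨E, E', rfl, h⟩⟩
  obtain ⟨rfl, rfl⟩ | ⟨rfl, rfl⟩ := conf_pair_eq_iff.1 h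
  · exact hD
  · exact hD.symm

/-- By Hall's theorem, if no nonempty `C` is contained in `Δ + 1 - |C|` of the sets `E i`, then the
classes of side `b` can be assigned bijectively to positions at which they are missing. -/
theorem exists_perm_notMem (E : Fin Δ → Set (Bool × Fin Δ)) (b : Bool)
    (h : ∀ C : Finset (Fin Δ), C.Nonempty → C.card + (positions E b C).card ≤ Δ) :
    ∃ σ : Equiv.Perm (Fin Δ), ∀ j, (b, j) ∉ E (σ j) := by
  classical
  obtain ⟨f, hf, hmem⟩ := (Fintype.all_card_le_filter_rel_iff_exists_injective
    (fun j i : Fin Δ => (b, j) ∉ E i)).1 fun C => by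
      obtain rfl | hC := C.eq_empty_or_nonempty
      · simp
      have h1 := h C hC
      have h2 : C.card ≤ ((positions E b C)ᶜ).card := by
        rw [Finset.card_compl, Fintype.card_fin]
        omega
      refine h2.trans (Finset.card_le_card fun i hi => ?_)
      simpa [mem_positions] using hi
  exact ⟨Equiv.ofBijective f (Finite.injective_iff_bijective.1 hf), hmem⟩

theorem isFixedPoint_doubleColoring (Δ : ℕ) : IsFixedPoint (doubleColoring Δ) := by
  refine isFixedPoint_of_map (P := doubleColoring Δ)
    -- The label sent to is the intersection over `K ∈ S` of the unions of the members of `K`.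
    (fun S => {x | ∀ K ∈ S.1, ∃ E : Set (Bool × Fin Δ), E ∈ K.1 ∧ x ∈ E}) (fun S hS => ?_)
    fun S T h => ?_
  · refine conf_mem_node_iff.2 fun b => ?_
    by_contra! hcon
    obtain ⟨σ, hσ⟩ := exists_perm_notMem _ b fun C hC => Nat.lt_succ_iff.1 (hcon C hC)
    -- A class missing from the intersection is missing from one of the unions, hence from every
    -- member of one `K ∈ S i`.
    have hσ' (i : Fin Δ) : ∃ K ∈ (S i).1, ∀ E : Set (Bool × Fin Δ), E ∈ K.1 →
        (b, σ.symm i) ∉ E := by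
      have := hσ (σ.symm i)
      rw [σ.apply_symm_apply] at this
      by_contra! hex
      exact this hex
    choose K hK hKE using hσ'
    obtain ⟨L, hL, hnode⟩ := choice_mem_node_of_mem_roundElim S hS K hK
    obtain ⟨C, hC, hcard⟩ := conf_mem_node_iff.1 hnode b
    -- For `j ∈ C`, position `σ j` lacks the class `(b, j)`, so at most `Δ - |C|` positions contain
    -- all of `C`, one too few.
    have hsub : C.map σ.toEmbedding ⊆ (positions L b C)ᶜ := by
      intro i hi
      obtain ⟨j, hj, rfl⟩ := Finset.mem_map.1 hi
      refine Finset.mem_compl.2 fun hmem => hKE (σ j) _ (hL _) ?_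
      rw [σ.symm_apply_apply]
      exact mem_positions.1 hmem j hj
    have := Finset.card_le_card hsub
    rw [Finset.card_map, Finset.card_compl, Fintype.card_fin] at this
    have := Finset.card_le_univ (positions L b C)
    rw [Fintype.card_fin] at this
    omega
  · obtain ⟨K, hK, K', hK', hKK⟩ := exists_sets_of_mem_roundElim_edge h
    refine conf_mem_edge_iff.2 fun x hx hx' => ?_
    obtain ⟨E, hE, hxE⟩ := hx K hK
    obtain ⟨E', hE', hxE'⟩ := hx' K' hK'
    exact conf_mem_edge_iff.1 (hKK E hE E' hE') x hxE hxE'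

/-! ### The relaxation -/

/-- A vertex is sent to its two classes, one per side. A singleton `C` suffices for the node
constraint, since its class appears at all `Δ` positions. -/
theorem relaxes_doubleColoring {W : Type} [Finite W] {H : SimpleGraph W}
    (col : W → Bool → Fin Δ)
    (hcol : ∀ u v b, H.Adj u v → col u b = col v b → (col u b).val = 0)
    (hspecial : ∀ u v b, H.Adj u v → (col u b).val = 0 → (col v (!b)).val ≠ 0) :
    Relaxes (homProblem Δ H) (doubleColoring Δ) := by
  choose w hw using fun c : (homProblem Δ H).node => c.2
  refine ⟨fun c _ => w c, fun c => (hw c).symm, fun c _ => {x | x.2 = col (w c) x.1},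
    fun c => conf_mem_node_iff.2 fun b => ⟨{col (w c) b}, Finset.singleton_nonempty _, ?_⟩,
    fun c c' _ _ h => conf_mem_edge_iff.2 ?_⟩
  · have : positions (fun _ : Fin Δ => {x | x.2 = col (w c) x.1}) b {col (w c) b} =
        Finset.univ := by
      ext i
      simp [mem_positions]
    rw [this]
    simp [add_comm]
  · have hadj : H.Adj (w c) (w c') := by
      obtain ⟨u, v, huv, h⟩ := h
      obtain ⟨rfl, rfl⟩ | ⟨rfl, rfl⟩ := conf_pair_eq_iff.1 h
      · exact huv
      · exact huv.symm
    rintro ⟨b, j⟩ hx hx'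
    change j = col (w c) b at hx
    subst hx
    by_cases h0 : (col (w c) b).val = 0
    · refine hspecial _ _ b hadj h0 ?_
      have : col (w c) b = col (w c') (!b) := by simpa [partner, h0] using hx'
      rw [← this, h0]
    · have : col (w c) b = col (w c') b := by simpa [partner, h0] using hx'
      exact h0 (hcol _ _ b hadj this)

theorem exists_coloring_of_induce_colorable {W : Type} {H : SimpleGraph W} (hΔ : 0 < Δ) (S : Set W)
    (hS : (H.induce S).Colorable (Δ - 1)) :
    ∃ col : W → Fin Δ, (∀ u v, H.Adj u v → col u = col v → (col u).val = 0) ∧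
      ∀ u, (col u).val = 0 → u ∉ S := by
  classical
  obtain ⟨C⟩ := hS
  -- Shifting the `Δ - 1` colors by one keeps color `0` for the vertices outside `S`.
  refine ⟨fun u => if h : u ∈ S then ⟨C ⟨u, h⟩ + 1, by have := (C ⟨u, h⟩).2; omega⟩ else ⟨0, hΔ⟩,
    fun u v huv h => ?_, fun u h => ?_⟩
  · by_contra hne
    by_cases hu : u ∈ S <;> by_cases hv : v ∈ S <;> simp [hu, hv] at h hne
    have hadj : (H.induce S).Adj ⟨u, hu⟩ ⟨v, hv⟩ := huv
    exact C.valid hadj (Fin.ext h)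
  · intro hu
    simp [hu] at h

theorem DeltaStar.relaxes {W : Type} [Finite W] {H : SimpleGraph W} (hΔ : 0 < Δ)
    (h : DeltaStar Δ H) : Relaxes (homProblem Δ H) (doubleColoring Δ) := by
  obtain ⟨S₀, S₁, h₀, h₁, hS⟩ := h
  obtain ⟨c₀, h₀, h₀'⟩ := exists_coloring_of_induce_colorable hΔ S₀ h₀
  obtain ⟨c₁, h₁, h₁'⟩ := exists_coloring_of_induce_colorable hΔ S₁ h₁
  refine relaxes_doubleColoring (fun u b => if b then c₁ u else c₀ u) ?_ ?_
  · rintro u v (_ | _) huv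
    · simpa using h₀ u v huv
    · simpa using h₁ u v huv
  · rintro u v (_ | _) huv h h'
    · exact hS u (h₀' u (by simpa using h)) v (h₁' v (by simpa using h')) huv
    · exact hS v (h₀' v (by simpa using h')) u (h₁' u (by simpa using h)) huv.symm

/-- Each coordinate is a proper coloring where it is nonzero in the `Fin Δ` representation: adjacent
vertices that agree in a coordinate have the value `0` there. -/
theorem deltaStar_targetGraph (Δ : ℕ) : DeltaStar Δ (targetGraph Δ) := by
  have hfin (i : Fin Δ) (hi : i.val ≠ 0) : i.val - 1 < Δ - 1 := by omega
  refine ⟨{p | p.1.val ≠ 0}, {p | p.2.val ≠ 0},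
    ⟨SimpleGraph.Coloring.mk (fun p => ⟨p.1.1.val - 1, hfin _ p.2⟩) ?_⟩,
    ⟨SimpleGraph.Coloring.mk (fun p => ⟨p.1.2.val - 1, hfin _ p.2⟩) ?_⟩, ?_⟩
  · rintro ⟨p, hp : p.1.val ≠ 0⟩ ⟨q, hq : q.1.val ≠ 0⟩ (h : (targetGraph Δ).Adj p q) heq
    have h1 : p.1.val - 1 = q.1.val - 1 := congrArg Fin.val heq
    have h2 : p.1 = q.1 := Fin.ext (by omega)
    simp [targetGraph, h2, hq] at h
  · rintro ⟨p, hp : p.2.val ≠ 0⟩ ⟨q, hq : q.2.val ≠ 0⟩ (h : (targetGraph Δ).Adj p q) heq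
    have h1 : p.2.val - 1 = q.2.val - 1 := congrArg Fin.val heq
    have h2 : p.2 = q.2 := Fin.ext (by omega)
    simp [targetGraph, h2, hq] at h
  · intro p hp q hq h
    have hp' : p.1.val = 0 := by simpa using hp
    have hq' : q.2.val = 0 := by simpa using hq
    simp [targetGraph, hp', hq'] at h


/-! ### Zero-round algorithms on double stars -/

/-- The double star: for each `b`, the hub `(b, p b)` is adjacent to the leaves `(b, k)`, `k ≠ p b`,
and to the other hub. -/
def doubleStar (p : Bool → Fin Δ) : SimpleGraph (Bool × Fin Δ) where
  Adj x y := if x.1 = y.1 then x.2 ≠ y.2 ∧ (x.2 = p x.1 ∨ y.2 = p y.1)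
    else x.2 = p x.1 ∧ y.2 = p y.1
  symm := ⟨fun x y h => by
    by_cases hxy : x.1 = y.1
    · rw [if_pos hxy] at h
      rw [if_pos hxy.symm]
      exact ⟨h.1.symm, h.2.symm⟩
    · rw [if_neg hxy] at h
      rw [if_neg (Ne.symm hxy)]
      exact h.symm⟩
  loopless := ⟨fun x h => by simp at h⟩

theorem doubleStar_adj_hub_iff (p : Bool → Fin Δ) (b : Bool) (y : Bool × Fin Δ) :
    (doubleStar p).Adj (b, p b) y ↔ y.1 = b ∧ y.2 ≠ p b ∨ y = (!b, p !b) := by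
  obtain ⟨c, k⟩ := y
  by_cases h : b = c
  · subst h
    simp [doubleStar, eq_comm]
  · obtain rfl : c = !b := by cases b <;> cases c <;> simp_all
    simp [doubleStar]

theorem doubleStar_adj_leaf_iff (p : Bool → Fin Δ) {x : Bool × Fin Δ} (hx : x.2 ≠ p x.1)
    (y : Bool × Fin Δ) : (doubleStar p).Adj x y ↔ y = (x.1, p x.1) := by
  obtain ⟨b, k⟩ := x
  obtain ⟨c, l⟩ := y
  by_cases h : b = c
  · subst h
    simp only [doubleStar, if_true, Prod.mk.injEq, true_and]
    constructor
    · rintro ⟨-, h | h⟩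
      · exact absurd h hx
      · exact h
    · rintro rfl
      exact ⟨hx, Or.inr rfl⟩
  · have : c ≠ b := Ne.symm h
    simp_all [doubleStar]

/-- The ports of the hub `(b, p b)`: port `p b` leads to the other hub. -/
def hubPort (p : Bool → Fin Δ) (b : Bool) : Fin Δ ≃ (doubleStar p).neighborSet (b, p b) where
  toFun k := ⟨if k = p b then (!b, p !b) else (b, k), by
    rw [SimpleGraph.mem_neighborSet, doubleStar_adj_hub_iff]
    by_cases h : k = p b <;> simp [h]⟩
  invFun y := if y.1.1 = b then y.1.2 else p b
  left_inv k := by by_cases h : k = p b <;> simp [h]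
  right_inv y := by
    obtain ⟨y, hy⟩ := y
    refine Subtype.ext ?_
    rw [SimpleGraph.mem_neighborSet, doubleStar_adj_hub_iff] at hy
    obtain ⟨h1, h2⟩ | rfl := hy
    · obtain ⟨c, k⟩ := y
      obtain rfl : c = b := h1
      simp [show k ≠ p c from h2]
    · simp

/-- The only port of a leaf. -/
def leafPort (p : Bool → Fin Δ) {x : Bool × Fin Δ} (hx : x.2 ≠ p x.1) :
    Fin 1 ≃ (doubleStar p).neighborSet x where
  toFun _ := ⟨(x.1, p x.1), (doubleStar_adj_leaf_iff p hx _).2 rfl⟩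
  invFun _ := 0
  left_inv _ := Subsingleton.elim _ _
  right_inv y := Subtype.ext ((doubleStar_adj_leaf_iff p hx _).1 y.2).symm

theorem doubleStar_connected (p : Bool → Fin Δ) : (doubleStar p).Connected := by
  have hub (b : Bool) : (doubleStar p).Reachable (b, p b) (false, p false) := by
    cases b
    · rfl
    · exact ((doubleStar_adj_hub_iff p true _).2 (Or.inr rfl)).reachable
  have h (x : Bool × Fin Δ) : (doubleStar p).Reachable x (false, p false) := by
    by_cases hx : x.2 = p x.1
    · obtain ⟨b, k⟩ := x
      obtain rfl : k = p b := hx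
      exact hub b
    · exact ((doubleStar_adj_leaf_iff p hx _).2 rfl).reachable.trans (hub _)
  have : Nonempty (Bool × Fin Δ) := ⟨(false, p false)⟩
  exact ⟨fun x y => (h x).trans (h y).symm⟩

/-- The degrees sum to `2 * (2 * Δ - 1)`, so this connected graph on `2 * Δ` vertices has `2 * Δ -
1` edges. -/
theorem doubleStar_isTree (p : Bool → Fin Δ) : (doubleStar p).IsTree := by
  classical
  refine SimpleGraph.isTree_iff_connected_and_card.2 ⟨doubleStar_connected p, ?_⟩
  have hΔ : 0 < Δ := (p false).pos
  have hdeg (x : Bool × Fin Δ) : (doubleStar p).degree x = if x.2 = p x.1 then Δ else 1 := by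
    rw [← SimpleGraph.card_neighborSet_eq_degree]
    split_ifs with h
    · obtain ⟨b, k⟩ := x
      obtain rfl : k = p b := h
      rw [← Fintype.card_congr (hubPort p b), Fintype.card_fin]
    · rw [← Fintype.card_congr (leafPort p h), Fintype.card_fin]
  have hside (b : Bool) : ∑ k, (doubleStar p).degree (b, k) = Δ + (Δ - 1) := by
    simp only [hdeg]
    rw [← Finset.add_sum_erase _ _ (Finset.mem_univ (p b)), if_pos rfl,
      Finset.sum_congr rfl fun k hk => if_neg (Finset.ne_of_mem_erase hk)]
    simp
  have hsum := (doubleStar p).sum_degrees_eq_twice_card_edges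
  rw [Fintype.sum_prod_type, Fintype.sum_bool, hside, hside] at hsum
  rw [Nat.card_eq_fintype_card, Nat.card_eq_fintype_card, ← SimpleGraph.edgeFinset_card,
    Fintype.card_prod, Fintype.card_bool, Fintype.card_fin]
  omega

/-- The double star as a network in which the hub of side `b` sees the orientations `o b`. -/
def starNetwork (p : Bool → Fin Δ) (o : Bool → Fin Δ → Bool)
    (ho : o false (p false) = !o true (p true)) : Network where
  V := Bool × Fin Δ
  finite_V := inferInstance
  G := doubleStar p
  deg x := if x.2 = p x.1 then Δ else 1
  port x := if h : x.2 = p x.1 then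
      ((finCongr (if_pos h)).trans (hubPort p x.1)).trans
        (Equiv.setCongr (congrArg _ (Prod.ext rfl h.symm)))
    else (finCongr (if_neg h)).trans (leafPort p h)
  -- Leaf `(b, k)` hangs at port `k` of its hub, so it sees the negation of `o b k`; between the
  -- hubs both ends use port `p b`, where `ho` gives consistency.
  out x y := if x.2 = p x.1 then (if y.1 = x.1 then o x.1 y.2 else o x.1 x.2) else !o x.1 x.2
  out_symm x y hxy := by
    by_cases hx : x.2 = p x.1
    · obtain ⟨b, k⟩ := x
      obtain rfl : k = p b := hx
      obtain ⟨h1, h2⟩ | rfl := (doubleStar_adj_hub_iff p b y).1 hxy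
      · simp [h1, h2]
      · cases b <;> simp [ho]
    · obtain rfl := (doubleStar_adj_leaf_iff p hx y).1 hxy
      simp [hx]

theorem starNetwork_isRegularTree (p : Bool → Fin Δ) (o : Bool → Fin Δ → Bool)
    (ho : o false (p false) = !o true (p true)) : (starNetwork p o ho).IsRegularTree Δ := by
  refine ⟨doubleStar_isTree p, fun x => ?_⟩
  by_cases h : x.2 = p x.1
  · exact Or.inr (if_pos h)
  · exact Or.inl (if_neg h)

theorem starNetwork_output_hub {Λ : Type} (A : ZeroRoundAlgorithm Λ) (p : Bool → Fin Δ)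
    (o : Bool → Fin Δ → Bool) (ho : o false (p false) = !o true (p true)) (b : Bool) (k : Fin Δ) :
    A.output (starNetwork p o ho) (b, p b) (hubPort p b k) = A (2 * Δ) Δ (o b) k := by
  -- The degree is an `if` expression, so it is generalized to `d` to let `subst` remove the casts.
  have key (d : ℕ) (hd : d = Δ) (e : Fin d ≃ (doubleStar p).neighborSet (b, p b))
      (he : e = (finCongr hd).trans (hubPort p b)) :
      A (Nat.card (Bool × Fin Δ)) d (fun i => (starNetwork p o ho).out (b, p b) (e i).1)
        (e.symm (hubPort p b k)) = A (2 * Δ) Δ (o b) k := by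
    subst hd
    subst he
    have hcard : Nat.card (Bool × Fin d) = 2 * d := by simp
    have hout : (fun i => (starNetwork p o ho).out (b, p b) (hubPort p b i).1) = o b := by
      funext i
      by_cases h : i = p b <;> simp [starNetwork, hubPort, h]
    have hk : (hubPort p b).symm (hubPort p b k) = k := Equiv.symm_apply_apply _ _
    change A (Nat.card (Bool × Fin d)) d
      (fun i => (starNetwork p o ho).out (b, p b) (hubPort p b i).1)
      ((hubPort p b).symm (hubPort p b k)) = _
    rw [hcard, hout, hk]
  refine key _ (if_pos rfl) ((starNetwork p o ho).port (b, p b)) ?_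
  exact (dif_pos rfl).trans (Equiv.ext fun i => Subtype.ext rfl)

/-- A `0`-round algorithm yields an output for every orientation pattern at a node of degree `Δ`,
such that outputs at oppositely oriented half-edges fit together. -/
theorem ZeroRoundSolvable.exists_outputs {P : Problem Δ} (hΔ : 0 < Δ) (h : ZeroRoundSolvable P) :
    ∃ A : (Fin Δ → Bool) → Fin Δ → P.Label, (∀ o, conf (A o) ∈ P.node) ∧
      ∀ o o' i j, o i = true → o' j = false → conf ![A o i, A o' j] ∈ P.edge := by
  obtain ⟨A, hA⟩ := h
  have key (o o' : Fin Δ → Bool) (i j : Fin Δ) (hij : o i = !o' j) :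
      conf (A (2 * Δ) Δ o) ∈ P.node ∧
        conf ![A (2 * Δ) Δ o i, A (2 * Δ) Δ o' j] ∈ P.edge := by
    let p : Bool → Fin Δ := fun b => if b then j else i
    let O : Bool → Fin Δ → Bool := fun b => if b then o' else o
    have hO : O false (p false) = !O true (p true) := hij
    obtain ⟨h1, h2⟩ := hA (starNetwork p O hO) (starNetwork_isRegularTree p O hO)
    constructor
    · have h3 := h1 (false, p false) (hubPort p false)
      have e : (fun k => A.output (starNetwork p O hO) (false, p false) (hubPort p false k)) =
          A (2 * Δ) Δ o := funext fun k => starNetwork_output_hub A p O hO false k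
      rw [← e]
      exact h3
    · have hadj : (doubleStar p).Adj (false, p false) (true, p true) :=
        (doubleStar_adj_hub_iff p false _).2 (Or.inr rfl)
      have h3 := h2 (false, p false) (true, p true) hadj
      have e (b : Bool) (hb : (doubleStar p).Adj (b, p b) (!b, p !b)) :
          A.output (starNetwork p O hO) (b, p b) ⟨(!b, p !b), hb⟩ = A (2 * Δ) Δ (O b) (p b) := by
        rw [← starNetwork_output_hub A p O hO b (p b)]
        congr 1
        exact Subtype.ext (if_pos rfl).symm
      have e1 := e false hadj
      have e2 := e true hadj.symm
      have e3 : conf ![A (2 * Δ) Δ (O false) (p false), A (2 * Δ) Δ (O true) (p true)] ∈ P.edge := by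
        rw [← e1, ← e2]
        exact h3
      exact e3
  -- For the node constraint alone, any second hub with the opposite orientation at the joining port
  -- will do.
  refine ⟨A (2 * Δ) Δ, fun o => (key o (fun _ => !o ⟨0, hΔ⟩) ⟨0, hΔ⟩ ⟨0, hΔ⟩ (by simp)).1,
    fun o o' i j h h' => (key o o' i j (by simp [h, h'])).2⟩

/-! ### Nontriviality -/

/-- On each side, some class is output both at an out-port and at an in-port. -/
theorem exists_class_out_in (E : (Fin Δ → Bool) → Fin Δ → Set (Bool × Fin Δ))
    (hE : ∀ o, IsNodeTuple (E o)) (b : Bool) :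
    ∃ c o i o' i', o i = true ∧ (b, c) ∈ E o i ∧ o' i' = false ∧ (b, c) ∈ E o' i' := by
  classical
  by_contra! hcon
  choose C hC hcard using fun o => hE o b
  -- Threshold patterns: the first `t` ports are out-ports. The used ports are all in-ports at `t =
  -- 0` and all out-ports at `t = Δ`, so they switch between some `t` and `t + 1`.
  let o (t : ℕ) : Fin Δ → Bool := fun i => decide (i.val < t)
  -- the ports used at each pattern are all out-ports or all in-ports
  have hside (t : ℕ) : (∀ i ∈ positions (E (o t)) b (C (o t)), o t i = true) ∨
      ∀ i ∈ positions (E (o t)) b (C (o t)), o t i = false := by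
    by_contra! hno
    obtain ⟨⟨i, hi, hi'⟩, j, hj, hj'⟩ := hno
    obtain ⟨c, hc⟩ := hC (o t)
    exact hcon c _ j _ i (by simpa using hj') (mem_positions.1 hj c hc) (by simpa using hi')
      (mem_positions.1 hi c hc)
  let Out (t : ℕ) : Prop := ∀ i ∈ positions (E (o t)) b (C (o t)), o t i = true
  have hpos (t : ℕ) : (positions (E (o t)) b (C (o t))).Nonempty := by
    rw [← Finset.card_pos]
    have h1 := hcard (o t)
    have h2 := Finset.card_le_univ (C (o t))
    rw [Fintype.card_fin] at h2
    omega
  have hzero : ¬ Out 0 := fun h => by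
    obtain ⟨i, hi⟩ := hpos 0
    simpa [o] using h i hi
  have hlast : Out Δ := fun i _ => by simp [o]
  have hstep : ∃ t < Δ, ¬ Out t ∧ Out (t + 1) := by
    by_contra! hno
    have (t : ℕ) : t ≤ Δ → ¬ Out t := by
      induction t with
      | zero => exact fun _ => hzero
      | succ t ih => exact fun ht => hno t ht (ih (by omega))
    exact this Δ le_rfl hlast
  obtain ⟨t, ht, hin, hout⟩ := hstep
  have hin := (hside t).resolve_left hin
  have hlt : (Finset.univ.filter fun i : Fin Δ => i.val < t).card = t := by
    rw [Fin.card_filter_val_lt]; omega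
  have hlt' : (Finset.univ.filter fun i : Fin Δ => i.val < t + 1).card = t + 1 := by
    rw [Fin.card_filter_val_lt]; omega
  have h1 : (positions (E (o t)) b (C (o t))).card ≤ Δ - t := by
    have : positions (E (o t)) b (C (o t)) ⊆ (Finset.univ.filter fun i : Fin Δ => i.val < t)ᶜ :=
      fun i hi => by simpa [o] using hin i hi
    have := Finset.card_le_card this
    rwa [Finset.card_compl, Fintype.card_fin, hlt] at this
  have h2 : (positions (E (o (t + 1))) b (C (o (t + 1)))).card ≤ t + 1 := by
    have : positions (E (o (t + 1))) b (C (o (t + 1))) ⊆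
        Finset.univ.filter fun i : Fin Δ => i.val < t + 1 :=
      fun i hi => by simpa [o] using hout i hi
    exact (Finset.card_le_card this).trans hlt'.le
  -- The bounds `Δ - t` and `t + 1` on the used ports force `|C (o t)| ≥ t + 1` and `|C (o (t + 1))|
  -- ≥ Δ - t`. These sizes add up to more than `Δ`, so the two sets share a class.
  obtain ⟨c, hc⟩ : (C (o t) ∩ C (o (t + 1))).Nonempty := by
    rw [← Finset.card_pos]
    have h3 := Finset.card_union_add_card_inter (C (o t)) (C (o (t + 1)))
    have h4 := Finset.card_le_univ (C (o t) ∪ C (o (t + 1)))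
    have h5 := hcard (o t)
    have h6 := hcard (o (t + 1))
    rw [Fintype.card_fin] at h4
    omega
  rw [Finset.mem_inter] at hc
  obtain ⟨i, hi⟩ := hpos (t + 1)
  obtain ⟨j, hj⟩ := hpos t
  exact hcon c _ i _ j (hout i hi) (mem_positions.1 hi c hc.2) (hin j hj)
    (mem_positions.1 hj c hc.1)

theorem not_zeroRoundSolvable_doubleColoring (hΔ : 0 < Δ) :
    ¬ ZeroRoundSolvable (doubleColoring Δ) := by
  intro h
  obtain ⟨A, hnode, hedge⟩ : ∃ A : (Fin Δ → Bool) → Fin Δ → Set (Bool × Fin Δ),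
      (∀ o, conf (A o) ∈ (doubleColoring Δ).node) ∧
      ∀ (o o' : Fin Δ → Bool) (i j : Fin Δ), o i = true → o' j = false →
        conf ![A o i, A o' j] ∈ (doubleColoring Δ).edge := h.exists_outputs hΔ
  have hcompat (o o' : Fin Δ → Bool) (i j : Fin Δ) (h : o i = true) (h' : o' j = false) :
      Compatible (A o i) (A o' j) := conf_mem_edge_iff.1 (hedge o o' i j h h')
  -- An ordinary class is its own partner, so it cannot occur at both an out-port and an in-port.
  have hspecial (b : Bool) : ∃ c : Fin Δ, c.val = 0 ∧ ∃ o i o' i', o i = true ∧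
      (b, c) ∈ A o i ∧ o' i' = false ∧ (b, c) ∈ A o' i' := by
    obtain ⟨c, o, i, o', i', h1, h2, h3, h4⟩ :=
      exists_class_out_in A (fun o => conf_mem_node_iff.1 (hnode o)) b
    refine ⟨c, ?_, o, i, o', i', h1, h2, h3, h4⟩
    by_contra hc
    exact hcompat o o' i i' h1 h3 (b, c) h2 (by simpa [partner, hc] using h4)
  obtain ⟨c, hc, o, i, -, -, h1, h2, -, -⟩ := hspecial false
  obtain ⟨c', hc', -, -, o', i', -, -, h3, h4⟩ := hspecial true
  obtain rfl : c = c' := Fin.ext (hc.trans hc'.symm)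
  -- The special class of side `false` at an out-port meets its partner, the special class of side
  -- `true`, at an in-port.
  exact hcompat o o' i i' h1 h3 (false, c) h2 (by simpa [partner, hc] using h4)

theorem DeltaStar.isNontrivialFixedPointRelaxation {W : Type} [Finite W] {H : SimpleGraph W}
    (hΔ : 0 < Δ) (h : DeltaStar Δ H) :
    IsNontrivialFixedPointRelaxation (homProblem Δ H) (doubleColoring Δ) :=
  ⟨h.relaxes hΔ, isFixedPoint_doubleColoring Δ, not_zeroRoundSolvable_doubleColoring hΔ⟩

end RoundElim

theorem mainTheorem1 (Δ : ℕ) (hΔ : 3 ≤ Δ) :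
    (∃ F : RoundElim.Problem Δ, RoundElim.IsNontrivialFixedPointRelaxation
      (RoundElim.homProblem Δ (RoundElim.targetGraph Δ)) F) ∧
    (∀ (W : Type) [Finite W] (H : SimpleGraph W), RoundElim.DeltaStar Δ H →
      ∃ F : RoundElim.Problem Δ, RoundElim.IsNontrivialFixedPointRelaxation
        (RoundElim.homProblem Δ H) F) := by
  have hpos : 0 < Δ := by omega
  exact ⟨⟨_, (RoundElim.deltaStar_targetGraph Δ).isNontrivialFixedPointRelaxation hpos⟩,
    fun _ _ _ h => ⟨_, h.isNontrivialFixedPointRelaxation hpos⟩⟩
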